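/- **Theorem (Simple regret lower bounds for infinitely many armed bandits).** An arm is a probability distribution $\nu$ on $\mathbb{R}$; an arm reservoir $\tilde{\mathcal L}$ is a probability distribution on the set of arms. Let $\mathcal L$ be the law of the mean $\mu=\int x\,\nu(dx)$ of an arm $\nu\sim\tilde{\mathcal L}$, and let $\bar\mu^\star=\inf\{m:\mathbb P_{\mu\sim\mathcal L}(\mu\le m)=1\}$ be its right end point. For $\beta,\tilde E,\tilde E',C>0$ and $0<\tilde B<1$, let $\mathcal S_\beta=\mathcal S_\beta(\tilde E,\tilde E',\tilde B,C)$ be the set of the reservoirs $\tilde{\mathcal L}$ such that - $\tilde{\mathcal L}$-almost every arm $\nu$ satisfies $\nu([-C,C])=1$, and - $\tilde E\,\varepsilon^{\beta}\le\mathbb P_{\mu\sim\mathcal L}(\mu>\bar\mu^\star-\varepsilon)\le\tilde E'\,\varepsilon^{\beta}$ for all $0\le\varepsilon\le\tilde B$. An algorithm $\mathcal A$ with horizon $T$, which may be randomized, proceeds as follows. At each of $T$ times it either picks an arm that it has already observed or asks for a new arm, drawn from $\tilde{\mathcal L}$ independently of the past, and it then observes one sample of the picked arm, drawn from that arm. Its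 choices depend only on its past choices and observations. After the $T$ samples it outputs one of the observed arms, $\widehat k$. Its simple regret is $r_T=\bar\mu^\star-\mu_{\widehat k}$. (1) Let $\beta<2$, and suppose that $\mathcal S_\beta$ contains a reservoir whose right end point satisfies $\bar\mu^\star<C$. Then there are $v>0$ and $T_0$, depending only on $\beta,\tilde E,\tilde E',\tilde B,C$, such that for every $T\ge T_0$ and every algorithm $\mathcal A$ with horizon $T$ there is a reservoir $\tilde{\mathcal L}\in\mathcal S_\beta$ for which $$\mathbb P_{\tilde{\mathcal L},\mathcal A}\left(r_T\ge v\,T^{-1/2}\right)>\tfrac13 .$$ (2) Let $\beta\ge2$, and suppose that $\mathcal S_\beta$ is non-empty. Then there are $v>0$ and $T_0$, depending only on $\beta,\tilde E,\tilde E',\tilde B,C$, such that for every $T\ge T_0$ and every algorithm $\mathcal A$ with horizon $T$ there is a reservoir $\tilde{\mathcal L}\in\mathcal S_\beta$ for which $$\mathbb P_{\tilde{\mathcal L},\mathcal A}\left(r_T\ge v\,T^{-1/\beta}\right)>\tfrac13 .$$ -/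

import Mathlib

open MeasureTheory ProbabilityTheory

noncomputable section

namespace InfBandit

/-- An arm is a probability distribution on the real line. -/
abbrev Arm : Type := ProbabilityMeasure ℝ

/-- An arm reservoir distribution is a probability distribution on the set of arms, which carries
the usual sigma-algebra generated by the evaluations at Borel sets. -/
abbrev Reservoir : Type := ProbabilityMeasure Arm

/-- The mean of an arm. -/
def armMean (ν : Arm) : ℝ := ∫ x, x ∂(ν : Measure ℝ)

/-- The tautological Markov kernel: from the arm `ν`, draw a sample of law `ν`. -/
def sampleKernel : Kernel Arm ℝ where
  toFun ν := (ν : Measure ℝ)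
  measurable' := measurable_subtype_coe

instance : IsMarkovKernel sampleKernel :=
  ⟨fun ν => inferInstanceAs (IsProbabilityMeasure (ν : Measure ℝ))⟩

theorem measurable_armMean : Measurable armMean :=
  (StronglyMeasurable.integral_kernel (κ := sampleKernel) (f := fun x : ℝ => x)
    stronglyMeasurable_id).measurable

/-- The mean reservoir distribution: the law of the mean of an arm drawn from the reservoir. -/
def meanReservoir (L : Reservoir) : Measure ℝ := (L : Measure Arm).map armMean

/-- The right end point of the mean reservoir distribution: the infimum of the `m` such that
the mean is at most `m` with probability one. -/
def rightEnd (L : Reservoir) : ℝ := sInf {m : ℝ | meanReservoir L (Set.Iic m) = 1}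

/-- The arms drawn from the reservoir are supported in `[-C, C]`. -/
def BoundedArms (L : Reservoir) (C : ℝ) : Prop :=
  ∀ᵐ ν : Arm ∂(L : Measure Arm), (ν : Measure ℝ) (Set.Icc (-C) C) = 1

/-- `β`-regularity of the mean reservoir distribution at its right end point. -/
def Regular (L : Reservoir) (β E E' B : ℝ) : Prop :=
  ∀ ε : ℝ, 0 ≤ ε → ε ≤ B →
    E * ε ^ β ≤ (meanReservoir L).real (Set.Ioi (rightEnd L - ε)) ∧
    (meanReservoir L).real (Set.Ioi (rightEnd L - ε)) ≤ E' * ε ^ β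

/-- The class of reservoirs with arms bounded by `C` and with `β`-regularity, with constants
`E` (lower bound), `E'` (upper bound) and range `B`. -/
def reservoirClass (β E E' B C : ℝ) : Set Reservoir :=
  {L | BoundedArms L C ∧ Regular L β E E' B}

/-- A history of length `n`: at each past time, the index of the arm that was pulled and the sample
that was observed. Arms are numbered `0, 1, 2, …` in the order in which they are discovered. -/
abbrev History (n : ℕ) : Type := Fin n → ℕ × ℝ

/-- The number of arms that have been observed in a history. -/
def numArms {n : ℕ} (h : History n) : ℕ := Finset.univ.sup fun i => (h i).1 + 1

/-- A (possibly randomized) algorithm with time horizon `T`. After a history of length `n` it picks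
the index of the next arm: an index `< numArms h` pulls again an arm that was already observed, and
the index `numArms h` asks for a new arm of the reservoir. After `T` samples it outputs one of the
observed arms. Both decisions depend only on the observed history. -/
structure Algorithm (T : ℕ) where
  choose : (n : ℕ) → Kernel (History n) ℕ
  markov_choose : ∀ n, IsMarkovKernel (choose n)
  choose_le : ∀ (n : ℕ) (h : History n), choose n h {a | a ≤ numArms h} = 1
  output : Kernel (History T) ℕ
  markov_output : IsMarkovKernel output
  output_lt : ∀ h : History T, output h {a | a < numArms h} = 1

attribute [instance] Algorithm.markov_choose Algorithm.markov_output

/-- The sequence of the arms of the reservoir, in the order of discovery. -/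
abbrev Arms : Type := ℕ → Arm

theorem measurable_pulledArm {n : ℕ} :
    Measurable fun p : (Arms × History n) × ℕ => p.1.1 p.2 :=
  measurable_from_prod_countable_left fun a =>
    (measurable_pi_apply a).comp measurable_fst

/-- Given the arms and the history, pick an arm by the algorithm and draw a sample of it. -/
def stepKernel {T : ℕ} (A : Algorithm T) (n : ℕ) : Kernel (Arms × History n) (ℕ × ℝ) :=
  (Kernel.prodMkLeft Arms (A.choose n)) ⊗ₖ (sampleKernel.comap _ measurable_pulledArm)

instance {T : ℕ} (A : Algorithm T) (n : ℕ) : IsMarkovKernel (stepKernel A n) := by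
  unfold stepKernel; infer_instance

/-- The law of the history of length `n`, given the arms. -/
def historyKernel {T : ℕ} (A : Algorithm T) : (n : ℕ) → Kernel Arms (History n)
  | 0 => Kernel.const Arms (Measure.dirac Fin.elim0)
  | n + 1 => (historyKernel A n ⊗ₖ stepKernel A n).map
      fun p => (Fin.snoc p.1 p.2 : History (n + 1))

theorem measurable_snoc (n : ℕ) : Measurable
    fun p : History n × (ℕ × ℝ) => (Fin.snoc p.1 p.2 : History (n + 1)) := by
  refine measurable_pi_lambda _ fun i => ?_
  refine Fin.lastCases ?_ (fun j => ?_) i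
  · simpa using measurable_snd
  · simpa [Function.comp_def] using
      (measurable_pi_apply j).comp (measurable_fst : Measurable (Prod.fst : History n × (ℕ × ℝ) → _))

instance {T : ℕ} (A : Algorithm T) (n : ℕ) : IsMarkovKernel (historyKernel A n) := by
  induction n with
  | zero => unfold historyKernel; infer_instance
  | succ n ih => exact Kernel.IsMarkovKernel.map _ (measurable_snoc n)

/-- The joint law of the arms (i.i.d. from the reservoir), of the history of the `T` samples,
and of the arm that is finally output. -/
def experiment {T : ℕ} (L : Reservoir) (A : Algorithm T) : Measure (Arms × History T × ℕ) :=
  (Measure.infinitePi fun _ : ℕ => (L : Measure Arm)) ⊗ₘ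
    (historyKernel A T ⊗ₖ Kernel.prodMkLeft Arms A.output)

instance {T : ℕ} (L : Reservoir) (A : Algorithm T) : IsProbabilityMeasure (experiment L A) := by
  unfold experiment; infer_instance

/-- The simple regret: the right end point minus the mean of the arm that is output. -/
def simpleRegret {T : ℕ} (L : Reservoir) (ω : Arms × History T × ℕ) : ℝ :=
  rightEnd L - armMean (ω.1 ω.2.2)

end InfBandit

end

noncomputable section

namespace InfBandit

open scoped ENNReal NNReal unitInterval

/-! One reservoir of the class defeats all algorithms and all horizons at once; it is enough that
the output arm is nearly optimal with probability below 2/3. For the rate `T ^ (-1/β)`, any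
reservoir of the class works. At most `T` arms are ever seen, so a union bound
(`experiment_outputArm_le`) makes the probability of outputting an arm within `ε` of the right end
at most `T * E' * ε ^ β`, which is at most 1/2 for `ε = v * T ^ (-1/β)`. For the rate `T ^ (-1/2)`,
the given reservoir is first replaced by two-point arms on `{-C, C}` with the same law of the mean.
Let `S` be the arms within `ε` of the right end and `W ⊇ S` those within `K * ε`, with `K` so large
that `W` has at least 8 times the mass of `S`. Since the right end lies strictly between `-C` and
`C`, two arms of `W` have Hellinger affinity at least `1 - η` with `η` of order `1 / T`. Now replace
the law of the `k`-th arm, from `ν'` in `W` to `ν` in `S`. The affinity of the two laws of the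
history drops by at most `η` times the expected number of pulls of `k`, summed over both laws
(`one_le_lintegral_armProd`), so the probability of outputting `k` at most doubles, up to an error
of that order (`outputProb_update_le`). Averaging over `ν` and `ν'` and summing over `k`
(`mul_experiment_outputArm_le`), the output probabilities add up to 1 and the pulls to `T`, whatever
the number of arms. Hence the output falls in `S` with probability at most about twice the mass
ratio plus a multiple of `η * T`. -/

/-! ### Likelihood ratios of histories. -/

/-- Integration against the law of the history of length `n + 1`. -/
theorem lintegral_historyKernel_succ {T : ℕ} (A : Algorithm T) (n : ℕ) (a : Arms)
    {F : History (n + 1) → ℝ≥0∞} (hF : Measurable F) :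
    ∫⁻ h, F h ∂historyKernel A (n + 1) a =
      ∫⁻ h, ∑' j, (∫⁻ x, F (Fin.snoc h (j, x) : History (n + 1)) ∂(a j : Measure ℝ)) *
        A.choose n h {j} ∂historyKernel A n a := by
  have hG : Measurable fun p : History n × (ℕ × ℝ) =>
      F (Fin.snoc p.1 p.2 : History (n + 1)) := hF.comp (measurable_snoc n)
  rw [historyKernel, Kernel.map_apply _ (measurable_snoc n), lintegral_map hF (measurable_snoc n),
    Kernel.lintegral_compProd _ _ _ hG]
  refine lintegral_congr fun h => ?_
  have hGh : Measurable fun c : ℕ × ℝ => F (Fin.snoc h c : History (n + 1)) :=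
    hG.comp measurable_prodMk_left
  rw [stepKernel, Kernel.lintegral_compProd _ _ _ hGh, Kernel.prodMkLeft_apply, lintegral_countable']
  rfl

/-- The product, over the past pulls of the arm `k`, of a function of the samples. -/
def armProd (k : ℕ) (s : ℝ → ℝ≥0) {n : ℕ} (h : History n) : ℝ≥0 :=
  ∏ i, if (h i).1 = k then s (h i).2 else 1

theorem measurable_armProd (k : ℕ) {s : ℝ → ℝ≥0} (hs : Measurable s) {n : ℕ} :
    Measurable (armProd k s : History n → ℝ≥0) := by
  refine Finset.measurable_prod _ fun i _ => Measurable.ite ?_ ?_ measurable_const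
  · exact (measurable_fst.comp (measurable_pi_apply i)) (measurableSet_singleton k)
  · exact hs.comp (measurable_snd.comp (measurable_pi_apply i))

theorem armProd_snoc (k : ℕ) (s : ℝ → ℝ≥0) {n : ℕ} (h : History n) (j : ℕ) (x : ℝ) :
    armProd k s (Fin.snoc h (j, x) : History (n + 1)) =
      armProd k s h * if j = k then s x else 1 := by
  simp [armProd, Fin.prod_univ_castSucc]

/-- Changing the law of the arm `k` multiplies the law of the history by the likelihood ratio. -/
theorem lintegral_historyKernel_update {T : ℕ} (A : Algorithm T) (a : Arms) (k : ℕ) (ν : Arm)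
    {s : ℝ → ℝ≥0} (hs : Measurable s)
    (hν : (ν : Measure ℝ) = (a k : Measure ℝ).withDensity fun x => (s x : ℝ≥0∞) ^ 2) (n : ℕ)
    {F : History n → ℝ≥0∞} (hF : Measurable F) :
    ∫⁻ h, F h ∂historyKernel A n (Function.update a k ν) =
      ∫⁻ h, F h * (armProd k s h : ℝ≥0∞) ^ 2 ∂historyKernel A n a := by
  induction n with
  | zero => simp [historyKernel, armProd]
  | succ n ih =>
    have hm : ∀ j : ℕ, Measurable fun p : History n × ℝ =>
        F (Fin.snoc p.1 (j, p.2) : History (n + 1)) := fun j =>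
      (hF.comp (measurable_snoc n)).comp
        (measurable_fst.prodMk (measurable_const.prodMk measurable_snd))
    have hsm : ∀ m, Measurable fun h : History m => (armProd k s h : ℝ≥0∞) ^ 2 := fun m =>
      (measurable_armProd k hs).coe_nnreal_ennreal.pow_const 2
    have hFs : Measurable fun h : History (n + 1) => F h * (armProd k s h : ℝ≥0∞) ^ 2 :=
      hF.mul (hsm _)
    rw [lintegral_historyKernel_succ A n _ hF, lintegral_historyKernel_succ A n _ hFs, ih]
    · refine lintegral_congr fun h => ?_
      rw [← ENNReal.tsum_mul_right]
      refine tsum_congr fun j => ?_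
      have hmj : Measurable fun x => F (Fin.snoc h (j, x) : History (n + 1)) :=
        (hm j).comp (measurable_prodMk_left (x := h))
      by_cases hj : j = k
      · subst hj
        simp only [Function.update_self, armProd_snoc, if_true, ENNReal.coe_mul, mul_pow]
        -- Only a pull of `k` sees the new law, and its density is exactly the new factor of the
        -- squared product.
        rw [hν, lintegral_withDensity_eq_lintegral_mul _ (hs.coe_nnreal_ennreal.pow_const 2) hmj,
          mul_right_comm, ← lintegral_mul_const _ ((hs.coe_nnreal_ennreal.pow_const 2).mul hmj)]
        congr 1
        refine lintegral_congr fun x => ?_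
        simp only [Pi.mul_apply]
        ring
      · simp only [Function.update_of_ne hj, armProd_snoc, if_neg hj, mul_one]
        rw [mul_right_comm, ← lintegral_mul_const _ hmj]
    · refine Measurable.tsum fun j => Measurable.mul ?_ ?_
      · exact Measurable.lintegral_prod_right' (hm j)
      · exact Kernel.measurable_coe _ (measurableSet_singleton j)

/-! ### Pull counts and Hellinger affinity. -/

/-- The expected number of pulls of the arm `k` during the first `n` steps. -/
def expPulls {T : ℕ} (A : Algorithm T) (n k : ℕ) (a : Arms) : ℝ≥0∞ :=
  ∑ i ∈ Finset.range n, ∫⁻ h, A.choose i h {k} ∂historyKernel A i a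

theorem measurable_expPulls {T : ℕ} (A : Algorithm T) (n k : ℕ) :
    Measurable (expPulls A n k) :=
  Finset.measurable_sum _ fun _ _ =>
    (Kernel.measurable_coe _ (measurableSet_singleton k)).lintegral_kernel

theorem tsum_measure_singleton_nat (μ : Measure ℕ) [IsProbabilityMeasure μ] :
    ∑' j, μ {j} = 1 := by
  rw [← lintegral_one (μ := μ) |>.trans measure_univ, lintegral_countable']
  simp

theorem tsum_expPulls {T : ℕ} (A : Algorithm T) (n : ℕ) (a : Arms) :
    ∑' k, expPulls A n k a = n := by
  have h : ∀ i, ∑' k, ∫⁻ h, A.choose i h {k} ∂historyKernel A i a = 1 := fun i => by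
    rw [← lintegral_tsum fun k =>
      (Kernel.measurable_coe _ (measurableSet_singleton k)).aemeasurable]
    simp [tsum_measure_singleton_nat]
  simp only [expPulls]
  rw [Summable.tsum_finsetSum fun _ _ => ENNReal.summable]
  simp [h]

/-- Bounds the square root of a likelihood ratio by two terms: 1 integrates to the old law, the
square to the changed law. -/
theorem coe_le_one_add_sq (x : ℝ≥0) : (x : ℝ≥0∞) ≤ 1 + (x : ℝ≥0∞) ^ 2 := by
  have : x ≤ 1 + x ^ 2 := by
    rw [← NNReal.coe_le_coe]
    push_cast
    nlinarith [sq_nonneg ((x : ℝ) - 1), x.2]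
  exact_mod_cast this

/-- The Hellinger affinity of the laws of the history, for two laws of the arm `k`, is close to
one if the arm `k` is rarely pulled. -/
theorem one_le_lintegral_armProd {T : ℕ} (A : Algorithm T) (a : Arms) (k : ℕ) (ν : Arm)
    {s : ℝ → ℝ≥0} (hs : Measurable s)
    (hν : (ν : Measure ℝ) = (a k : Measure ℝ).withDensity fun x => (s x : ℝ≥0∞) ^ 2)
    {η : ℝ≥0∞} (hη : 1 ≤ ∫⁻ x, s x ∂(a k : Measure ℝ) + η) (n : ℕ) :
    1 ≤ ∫⁻ h, armProd k s h ∂historyKernel A n a +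
      η * (expPulls A n k a + expPulls A n k (Function.update a k ν)) := by
  induction n with
  | zero => simp [historyKernel, armProd]
  | succ n ih =>
    have hsm : ∀ m, Measurable fun h : History m => (armProd k s h : ℝ≥0∞) := fun m =>
      (measurable_armProd k hs).coe_nnreal_ennreal
    have hc : Measurable fun h : History n => A.choose n h {k} :=
      Kernel.measurable_coe _ (measurableSet_singleton k)
    have hcs : Measurable fun h : History n =>
        A.choose n h {k} + A.choose n h {k} * (armProd k s h : ℝ≥0∞) ^ 2 :=
      hc.add (hc.mul ((hsm n).pow_const 2))
    -- One more sample costs affinity only when `k` is pulled, and then at most `η` times the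
    -- current square root of the likelihood ratio. This loss is charged to the pull probabilities
    -- under both laws.
    have key : ∫⁻ h, (armProd k s h : ℝ≥0∞) ∂historyKernel A n a ≤
        ∫⁻ h, armProd k s h ∂historyKernel A (n + 1) a +
          η * (∫⁻ h, A.choose n h {k} ∂historyKernel A n a +
            ∫⁻ h, A.choose n h {k} ∂historyKernel A n (Function.update a k ν)) := by
      rw [lintegral_historyKernel_succ A n _ (hsm _),
        lintegral_historyKernel_update A a k ν hs hν n hc, ← lintegral_add_left hc,
        ← lintegral_const_mul _ hcs, ← lintegral_add_right _ (hcs.const_mul η)]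
      refine lintegral_mono fun h => ?_
      have h1 : ∀ j, (∫⁻ x, (armProd k s (Fin.snoc h (j, x) : History (n + 1)) : ℝ≥0∞)
          ∂(a j : Measure ℝ)) =
          armProd k s h * if j = k then ∫⁻ x, s x ∂(a k : Measure ℝ) else 1 := by
        intro j
        simp only [armProd_snoc, ENNReal.coe_mul]
        rw [lintegral_const_mul' _ _ ENNReal.coe_ne_top]
        congr 1
        split_ifs with hj
        · rw [hj]
        · simp
      have h2 : (1 : ℝ≥0∞) ≤ (∑' j, (if j = k then ∫⁻ x, s x ∂(a k : Measure ℝ) else 1) *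
          A.choose n h {j}) + η * A.choose n h {k} := by
        have : η * A.choose n h {k} =
            ∑' j, (if j = k then η else 0) * A.choose n h {j} := by
          rw [tsum_eq_single k fun j hj => by simp [hj]]
          simp
        rw [this, ← ENNReal.tsum_add]
        refine (tsum_measure_singleton_nat (A.choose n h)).symm.le.trans ?_
        refine ENNReal.tsum_le_tsum fun j => ?_
        rw [← add_mul]
        refine le_mul_of_one_le_left' ?_
        split_ifs
        · exact hη
        · simp
      have h3 := coe_le_one_add_sq (armProd k s h)
      calc (armProd k s h : ℝ≥0∞)
          = armProd k s h * 1 := (mul_one _).symm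
        _ ≤ armProd k s h * ((∑' j, (if j = k then ∫⁻ x, s x ∂(a k : Measure ℝ) else 1) *
              A.choose n h {j}) + η * A.choose n h {k}) := by gcongr
        _ = (∑' j, (∫⁻ x, (armProd k s (Fin.snoc h (j, x) : History (n + 1)) : ℝ≥0∞)
              ∂(a j : Measure ℝ)) * A.choose n h {j}) +
              armProd k s h * (η * A.choose n h {k}) := by
            rw [mul_add, ← ENNReal.tsum_mul_left]
            simp only [h1, mul_assoc]
        _ ≤ _ := by
            refine add_le_add le_rfl ?_
            calc (armProd k s h : ℝ≥0∞) * (η * A.choose n h {k})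
                ≤ (1 + (armProd k s h : ℝ≥0∞) ^ 2) * (η * A.choose n h {k}) := by gcongr
              _ = _ := by ring
    calc (1 : ℝ≥0∞) ≤ _ := ih
      _ ≤ _ := add_le_add_left key _
      _ = _ := by
        simp only [expPulls, Finset.sum_range_succ]
        ring

/-! ### Output probabilities under a change of one arm. -/

/-- The probability, given the arms, that the arm `k` is output. -/
def outputProb {T : ℕ} (A : Algorithm T) (k : ℕ) (a : Arms) : ℝ≥0∞ :=
  ∫⁻ h, A.output h {k} ∂historyKernel A T a

theorem measurable_outputProb {T : ℕ} (A : Algorithm T) (k : ℕ) :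
    Measurable (outputProb A k) :=
  (Kernel.measurable_coe _ (measurableSet_singleton k)).lintegral_kernel

theorem tsum_outputProb {T : ℕ} (A : Algorithm T) (a : Arms) : ∑' k, outputProb A k a = 1 := by
  simp only [outputProb]
  rw [← lintegral_tsum fun k =>
    (Kernel.measurable_coe _ (measurableSet_singleton k)).aemeasurable]
  simp [tsum_measure_singleton_nat]

/-- With `S` the square root of the likelihood ratio and `f ∈ [0, 1]` the output probability given
the history, integrate the pointwise bound `f * S ^ 2 + 4 * S ≤ 2 * f + 2 * S ^ 2 + 2` and insert
the lower bound on the affinity, the integral of `S`. -/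
theorem outputProb_update_le {T : ℕ} (A : Algorithm T) (a : Arms) (k : ℕ) (ν : Arm)
    {s : ℝ → ℝ≥0} (hs : Measurable s)
    (hν : (ν : Measure ℝ) = (a k : Measure ℝ).withDensity fun x => (s x : ℝ≥0∞) ^ 2)
    {η : ℝ≥0∞} (hη : 1 ≤ ∫⁻ x, s x ∂(a k : Measure ℝ) + η) :
    outputProb A k (Function.update a k ν) ≤ 2 * outputProb A k a +
      4 * (η * (expPulls A T k a + expPulls A T k (Function.update a k ν))) := by
  have hF : Measurable fun h : History T => A.output h {k} :=
    Kernel.measurable_coe _ (measurableSet_singleton k)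
  have hS : Measurable fun h : History T => (armProd k s h : ℝ≥0∞) :=
    (measurable_armProd k hs).coe_nnreal_ennreal
  have hS2 : ∫⁻ h, (armProd k s h : ℝ≥0∞) ^ 2 ∂historyKernel A T a = 1 := by
    have := lintegral_historyKernel_update A a k ν hs hν T (F := fun _ => 1) measurable_const
    simpa using this.symm
  have hS1 : ∫⁻ h, (armProd k s h : ℝ≥0∞) ∂historyKernel A T a ≠ ∞ := by
    refine ne_top_of_le_ne_top (b := 2) (by simp) ?_
    calc ∫⁻ h, (armProd k s h : ℝ≥0∞) ∂historyKernel A T a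
        ≤ ∫⁻ h, (1 + (armProd k s h : ℝ≥0∞) ^ 2) ∂historyKernel A T a :=
          lintegral_mono fun h => coe_le_one_add_sq _
      _ = 2 := by
          rw [lintegral_add_left measurable_const, hS2]
          simp [one_add_one_eq_two]
  have main : outputProb A k (Function.update a k ν) +
      4 * ∫⁻ h, (armProd k s h : ℝ≥0∞) ∂historyKernel A T a ≤ 2 * outputProb A k a + 4 := by
    have e : 2 * outputProb A k a + 4 = ∫⁻ h, (2 * A.output h {k} +
        (2 * (armProd k s h : ℝ≥0∞) ^ 2 + 2)) ∂historyKernel A T a := by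
      rw [lintegral_add_left (hF.const_mul 2), lintegral_const_mul _ hF,
        lintegral_add_left ((hS.pow_const 2).const_mul 2),
        lintegral_const_mul _ (hS.pow_const 2), hS2]
      simp only [outputProb, lintegral_const, measure_univ, mul_one]
      norm_num
    have hFS : Measurable fun h : History T =>
        A.output h {k} * (armProd k s h : ℝ≥0∞) ^ 2 := hF.mul (hS.pow_const 2)
    rw [e, outputProb, lintegral_historyKernel_update A a k ν hs hν T hF,
      ← lintegral_const_mul _ hS, ← lintegral_add_left hFS]
    refine lintegral_mono fun h => ?_
    have hf : A.output h {k} ≤ 1 := prob_le_one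
    lift A.output h {k} to ℝ≥0 using ne_top_of_le_ne_top (by simp) hf with f
    have hf1 : f ≤ 1 := by exact_mod_cast hf
    have : f * (armProd k s h) ^ 2 + 4 * armProd k s h ≤
        2 * f + (2 * (armProd k s h) ^ 2 + 2) := by
      rw [← NNReal.coe_le_coe] at hf1 ⊢
      push_cast at hf1 ⊢
      generalize (armProd k s h : ℝ) = S
      -- The difference of the two sides is `f * (S - 2) ^ 2 + 2 * (1 - f) * (S - 1) ^ 2`.
      nlinarith [mul_nonneg f.2 (sq_nonneg (S - 2)),
        mul_nonneg (sub_nonneg.2 hf1) (sq_nonneg (S - 1)), sq_nonneg (S - 1)]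
    exact_mod_cast this
  have hc := one_le_lintegral_armProd A a k ν hs hν hη T
  -- Four times the affinity is added to both sides; it is finite, so it cancels.
  refine (ENNReal.add_le_add_iff_right
    (a := 4 * ∫⁻ h, (armProd k s h : ℝ≥0∞) ∂historyKernel A T a)
    (ENNReal.mul_ne_top (by simp) hS1)).1 (main.trans ?_)
  calc 2 * outputProb A k a + 4 = 2 * outputProb A k a + 4 * 1 := by rw [mul_one]
    _ ≤ 2 * outputProb A k a + 4 * (∫⁻ h, armProd k s h ∂historyKernel A T a +
      η * (expPulls A T k a + expPulls A T k (Function.update a k ν))) := by gcongr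
    _ = _ := by ring

/-! ### At most `T` arms are seen, and the law of the output arm. -/

theorem measurableSet_numArms_le (n m : ℕ) : MeasurableSet {h : History n | numArms h ≤ m} := by
  have : {h : History n | numArms h ≤ m} = ⋂ i, {h : History n | (h i).1 ∈ {j | j + 1 ≤ m}} := by
    ext h
    simp [numArms]
  rw [this]
  exact MeasurableSet.iInter fun i =>
    (measurable_fst.comp (measurable_pi_apply i)) (Set.to_countable _).measurableSet

theorem numArms_snoc_le {n : ℕ} {h : History n} {j : ℕ} {x : ℝ} {m : ℕ} (hh : numArms h ≤ m)
    (hj : j + 1 ≤ m) : numArms (Fin.snoc h (j, x) : History (n + 1)) ≤ m := by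
  refine Finset.sup_le fun i _ => ?_
  refine Fin.lastCases ?_ (fun i => ?_) i
  · simpa using hj
  · simpa using (Finset.le_sup (f := fun i => (h i).1 + 1) (Finset.mem_univ i)).trans hh

theorem ae_numArms_le {T : ℕ} (A : Algorithm T) (n : ℕ) (a : Arms) :
    ∀ᵐ h ∂historyKernel A n a, numArms h ≤ n := by
  induction n with
  | zero => exact ae_of_all _ fun h => by simp [numArms]
  | succ n ih =>
    have hms : ∀ m, MeasurableSet {h : History m | ¬ numArms h ≤ m} := fun m =>
      (measurableSet_numArms_le m m).compl
    rw [ae_iff, ← lintegral_indicator_one (hms _),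
      lintegral_historyKernel_succ A n a (measurable_one.indicator (hms _))]
    rw [← lintegral_zero (μ := historyKernel A n a)]
    refine lintegral_congr_ae ?_
    filter_upwards [ih] with h hh
    rw [ENNReal.tsum_eq_zero]
    intro j
    by_cases hj : j ≤ n
    · have : ∀ x : ℝ, numArms (Fin.snoc h (j, x) : History (n + 1)) ≤ n + 1 := fun x =>
        numArms_snoc_le (hh.trans n.le_succ) (by omega)
      simp [Set.indicator, (this _).not_gt]
    -- An index beyond `n` would skip an undiscovered arm, which `choose_le` forbids almost surely.
    · refine mul_eq_zero_of_right _ (measure_mono_null (t := {b | b ≤ numArms h}ᶜ) ?_ ?_)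
      · rintro _ rfl
        simp only [Set.mem_compl_iff, Set.mem_ofPred_eq]
        omega
      · exact (prob_compl_eq_zero_iff (Set.to_countable _).measurableSet).2 (A.choose_le n h)

theorem outputProb_eq_zero {T : ℕ} (A : Algorithm T) {k : ℕ} (hk : T ≤ k) (a : Arms) :
    outputProb A k a = 0 := by
  rw [outputProb, ← lintegral_zero (μ := historyKernel A T a)]
  refine lintegral_congr_ae ?_
  filter_upwards [ae_numArms_le A T a] with h hh
  refine measure_mono_null (t := {b | b < numArms h}ᶜ) ?_ ?_
  · rintro _ rfl
    simp only [Set.mem_compl_iff, Set.mem_ofPred_eq]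
    omega
  · exact (prob_compl_eq_zero_iff (Set.to_countable _).measurableSet).2 (A.output_lt h)

theorem outputProb_le_one {T : ℕ} (A : Algorithm T) (k : ℕ) (a : Arms) : outputProb A k a ≤ 1 :=
  (ENNReal.le_tsum k).trans (tsum_outputProb A a).le

theorem measurable_outputArm {T : ℕ} :
    Measurable fun ω : Arms × History T × ℕ => ω.1 ω.2.2 := by
  have : Measurable fun p : Arms × ℕ => p.1 p.2 :=
    measurable_from_prod_countable_left fun k => measurable_pi_apply k
  exact this.comp (measurable_fst.prodMk (measurable_snd.comp measurable_snd))

/-- The law of the arm that is output. -/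
theorem experiment_outputArm {T : ℕ} (L : Reservoir) (A : Algorithm T) {S : Set Arm}
    (hS : MeasurableSet S) :
    experiment L A {ω | ω.1 ω.2.2 ∈ S} =
      ∑' k, ∫⁻ a, S.indicator 1 (a k) * outputProb A k a
        ∂(Measure.infinitePi fun _ : ℕ => (L : Measure Arm)) := by
  have hSm : MeasurableSet {ω : Arms × History T × ℕ | ω.1 ω.2.2 ∈ S} := measurable_outputArm hS
  have hg : ∀ k, Measurable fun a : Arms => S.indicator 1 (a k) * outputProb A k a := fun k =>
    ((measurable_one.indicator hS).comp (measurable_pi_apply k)).mul (measurable_outputProb A k)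
  rw [← lintegral_tsum fun k => (hg k).aemeasurable, experiment, Measure.compProd_apply hSm]
  refine lintegral_congr fun a => ?_
  have hSa : MeasurableSet (Prod.mk a ⁻¹' {ω : Arms × History T × ℕ | ω.1 ω.2.2 ∈ S}) :=
    measurable_prodMk_left hSm
  rw [← lintegral_indicator_one hSa,
    Kernel.lintegral_compProd _ _ _ (measurable_one.indicator hSa)]
  simp only [outputProb]
  simp_rw [← lintegral_const_mul _ (Kernel.measurable_coe A.output (measurableSet_singleton _))]
  rw [← lintegral_tsum fun k =>
    ((Kernel.measurable_coe _ (measurableSet_singleton k)).const_mul _).aemeasurable]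
  refine lintegral_congr fun h => ?_
  rw [Kernel.prodMkLeft_apply, lintegral_countable']
  rfl

/-- The output arm is one of the first `T` arms of the reservoir. -/
theorem experiment_outputArm_le {T : ℕ} (L : Reservoir) (A : Algorithm T) {S : Set Arm}
    (hS : MeasurableSet S) :
    experiment L A {ω | ω.1 ω.2.2 ∈ S} ≤ T * (L : Measure Arm) S := by
  rw [experiment_outputArm L A hS, tsum_eq_sum (s := Finset.range T) fun k hk => by
    simp [outputProb_eq_zero A (by simpa using hk)]]
  calc _ ≤ ∑ k ∈ Finset.range T, (L : Measure Arm) S := by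
        refine Finset.sum_le_sum fun k _ => ?_
        rw [← (measurePreserving_eval_infinitePi (fun _ : ℕ => (L : Measure Arm)) k).measure_preimage
          hS.nullMeasurableSet, ← lintegral_indicator_one (measurable_pi_apply k hS)]
        refine lintegral_mono fun a => ?_
        exact (mul_le_mul_right (outputProb_le_one A k a) _).trans (mul_one _).le
    _ = _ := by simp

/-! ### Resampling one arm and averaging the comparison. -/

theorem measurable_update_pair (k : ℕ) :
    Measurable fun p : Arms × Arm => (Function.update p.1 k p.2 : Arms) := by
  refine measurable_pi_lambda _ fun i => ?_
  by_cases hi : i = k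
  · subst hi
    simpa using measurable_snd
  · simpa [Function.update_of_ne hi, Function.comp_def] using
      (measurable_pi_apply i).comp (measurable_fst : Measurable (Prod.fst : Arms × Arm → Arms))

/-- Drawing anew one coordinate of an independent family does not change its law. -/
theorem map_update_infinitePi (L : Reservoir) (k : ℕ) :
    ((Measure.infinitePi fun _ : ℕ => (L : Measure Arm)).prod (L : Measure Arm)).map
      (fun p => (Function.update p.1 k p.2 : Arms)) =
      Measure.infinitePi fun _ : ℕ => (L : Measure Arm) := by
  refine Measure.eq_infinitePi _ fun s t ht => ?_
  rw [Measure.map_apply (measurable_update_pair k)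
    (MeasurableSet.pi s.countable_toSet fun i _ => ht i)]
  by_cases hk : k ∈ s
  · have : (fun p : Arms × Arm => (Function.update p.1 k p.2 : Arms)) ⁻¹' (Set.pi s t) =
        (Set.pi (s.erase k : Finset ℕ) t) ×ˢ t k := by
      ext p
      simp only [Set.mem_preimage, Set.mem_pi, Set.mem_prod, Finset.mem_coe, Finset.mem_erase]
      constructor
      · intro h
        refine ⟨fun i hi => ?_, by simpa using h k hk⟩
        simpa [Function.update_of_ne hi.1] using h i hi.2
      · rintro ⟨h1, h2⟩ i hi
        by_cases hik : i = k
        · subst hik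
          simpa using h2
        · simpa [Function.update_of_ne hik] using h1 i ⟨hik, hi⟩
    rw [this, Measure.prod_prod, Measure.infinitePi_pi _ fun i _ => ht i,
      Finset.prod_erase_mul _ _ hk]
  · have : (fun p : Arms × Arm => (Function.update p.1 k p.2 : Arms)) ⁻¹' (Set.pi s t) =
        (Set.pi s t) ×ˢ Set.univ := by
      ext p
      simp only [Set.mem_preimage, Set.mem_pi, Set.mem_prod, Finset.mem_coe, Set.mem_univ,
        and_true]
      refine forall₂_congr fun i hi => ?_
      rw [Function.update_of_ne (fun h : i = k => hk (h ▸ hi))]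
    rw [this, Measure.prod_prod, Measure.infinitePi_pi _ fun i _ => ht i]
    simp

theorem lintegral_infinitePi_update (L : Reservoir) (k : ℕ) {g : Arms → ℝ≥0∞}
    (hg : Measurable g) :
    ∫⁻ a, g a ∂(Measure.infinitePi fun _ : ℕ => (L : Measure Arm)) =
      ∫⁻ a, ∫⁻ ν, g (Function.update a k ν) ∂(L : Measure Arm)
        ∂(Measure.infinitePi fun _ : ℕ => (L : Measure Arm)) := by
  have hgu : Measurable fun p : Arms × Arm => g (Function.update p.1 k p.2) :=
    hg.comp (measurable_update_pair k)
  conv_lhs => rw [← map_update_infinitePi L k]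
  rw [lintegral_map hg (measurable_update_pair k), lintegral_prod _ hgu.aemeasurable]

/-- The arm `ν` is absolutely continuous with respect to `ν'`, and their Hellinger affinity is at
least `1 - η`. -/
def HellingerClose (ν' ν : Arm) (η : ℝ≥0∞) : Prop :=
  ∃ s : ℝ → ℝ≥0, Measurable s ∧
    (ν : Measure ℝ) = (ν' : Measure ℝ).withDensity (fun x => (s x : ℝ≥0∞) ^ 2) ∧
    1 ≤ ∫⁻ x, s x ∂(ν' : Measure ℝ) + η

theorem outputProb_update_le_of_hellingerClose {T : ℕ} (A : Algorithm T) (a : Arms) (k : ℕ)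
    {ν ν' : Arm} {η : ℝ≥0∞} (h : HellingerClose ν' ν η) :
    outputProb A k (Function.update a k ν) ≤ 2 * outputProb A k (Function.update a k ν') +
      4 * (η * (expPulls A T k (Function.update a k ν') +
        expPulls A T k (Function.update a k ν))) := by
  obtain ⟨s, hs, hν, hη⟩ := h
  have := outputProb_update_le A (Function.update a k ν') k ν hs (by simpa using hν)
    (η := η) (by simpa using hη)
  simpa using this

/-- Since the arms are independent, the `k`-th may be redrawn with the others frozen. The comparison
of `ν` with `ν'` is then integrated over `ν` in `S` and `ν'` in `W`: the free variable of each term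
contributes the factor `L W` or `L S`. -/
theorem mul_lintegral_indicator_outputProb_le {T : ℕ} (A : Algorithm T) (L : Reservoir)
    {S W : Set Arm} (hS : MeasurableSet S) (hW : MeasurableSet W) {η : ℝ≥0∞}
    (hSW : ∀ᵐ ν ∂(L : Measure Arm), ν ∈ S → ∀ᵐ ν' ∂(L : Measure Arm), ν' ∈ W →
      HellingerClose ν' ν η) (k : ℕ) :
    (L : Measure Arm) W * ∫⁻ a, S.indicator 1 (a k) * outputProb A k a
        ∂(Measure.infinitePi fun _ : ℕ => (L : Measure Arm)) ≤
      2 * (L : Measure Arm) S * ∫⁻ a, outputProb A k a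
        ∂(Measure.infinitePi fun _ : ℕ => (L : Measure Arm)) +
      4 * (η * ((L : Measure Arm) W + (L : Measure Arm) S)) * ∫⁻ a, expPulls A T k a
        ∂(Measure.infinitePi fun _ : ℕ => (L : Measure Arm)) := by
  have hΦ := measurable_outputProb A k
  have hN := measurable_expPulls A T k
  have hu := measurable_update_pair k
  have hg : Measurable fun a : Arms => S.indicator 1 (a k) * outputProb A k a :=
    ((measurable_one.indicator hS).comp (measurable_pi_apply k)).mul hΦ
  have hI : ∀ {f : Arms → ℝ≥0∞}, Measurable f →
      Measurable fun a : Arms => ∫⁻ ν, f (Function.update a k ν) ∂(L : Measure Arm) := fun hf =>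
    (hf.comp hu).lintegral_prod_right'
  rw [lintegral_infinitePi_update L k hg, lintegral_infinitePi_update L k hΦ,
    lintegral_infinitePi_update L k hN, ← lintegral_const_mul _ (hI hg),
    ← lintegral_const_mul _ (hI hΦ), ← lintegral_const_mul _ (hI hN),
    ← lintegral_add_left ((hI hΦ).const_mul _)]
  refine lintegral_mono fun a => ?_
  have hua : Measurable fun ν : Arm => (Function.update a k ν : Arms) := measurable_update a
  have hΦa : Measurable fun ν : Arm => outputProb A k (Function.update a k ν) := hΦ.comp hua
  have hNa : Measurable fun ν : Arm => expPulls A T k (Function.update a k ν) := hN.comp hua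
  set Φ : Arm → ℝ≥0∞ := fun ν => outputProb A k (Function.update a k ν)
  set N : Arm → ℝ≥0∞ := fun ν => expPulls A T k (Function.update a k ν)
  have e : ∫⁻ ν, S.indicator 1 (Function.update a k ν k) * Φ ν ∂(L : Measure Arm) =
      ∫⁻ ν in S, Φ ν ∂(L : Measure Arm) := by
    rw [← lintegral_indicator hS]
    refine lintegral_congr fun ν => ?_
    by_cases h : ν ∈ S <;> simp [h]
  calc (L : Measure Arm) W * ∫⁻ ν, S.indicator 1 (Function.update a k ν k) * Φ ν ∂(L : Measure Arm)
      = ∫⁻ ν in S, (L : Measure Arm) W * Φ ν ∂(L : Measure Arm) := by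
        rw [e, lintegral_const_mul _ hΦa]
    _ ≤ ∫⁻ ν in S, (2 * ∫⁻ ν', Φ ν' ∂(L : Measure Arm) +
          4 * (η * (∫⁻ ν', N ν' ∂(L : Measure Arm) + (L : Measure Arm) W * N ν)))
          ∂(L : Measure Arm) := by
        refine lintegral_mono_ae ((ae_restrict_iff' hS).2 ?_)
        filter_upwards [hSW] with ν hν hνS
        calc (L : Measure Arm) W * Φ ν = ∫⁻ _ in W, Φ ν ∂(L : Measure Arm) := by
              simp [mul_comm]
          _ ≤ ∫⁻ ν' in W, (2 * Φ ν' + 4 * (η * (N ν' + N ν))) ∂(L : Measure Arm) := by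
              refine lintegral_mono_ae ((ae_restrict_iff' hW).2 ?_)
              filter_upwards [hν hνS] with ν' hν' hW'
              exact outputProb_update_le_of_hellingerClose A a k (hν' hW')
          _ = 2 * ∫⁻ ν' in W, Φ ν' ∂(L : Measure Arm) +
              4 * (η * (∫⁻ ν' in W, N ν' ∂(L : Measure Arm) + (L : Measure Arm) W * N ν)) := by
              rw [lintegral_add_left (hΦa.const_mul 2), lintegral_const_mul _ hΦa,
                lintegral_const_mul _ ((hNa.add_const _).const_mul _),
                lintegral_const_mul _ (hNa.add_const _), lintegral_add_left hNa]
              simp [mul_comm]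
          _ ≤ _ := by
              -- Dropping the restriction to `W` yields averages over a fresh arm, that is, over the
              -- original experiment.
              gcongr <;> exact Measure.restrict_le_self
    _ = 2 * (L : Measure Arm) S * ∫⁻ ν', Φ ν' ∂(L : Measure Arm) +
          4 * (η * ((L : Measure Arm) S * ∫⁻ ν', N ν' ∂(L : Measure Arm) +
            (L : Measure Arm) W * ∫⁻ ν in S, N ν ∂(L : Measure Arm))) := by
        rw [lintegral_add_left measurable_const,
          lintegral_const_mul _ (((hNa.const_mul _).const_add _).const_mul _),
          lintegral_const_mul _ ((hNa.const_mul _).const_add _),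
          lintegral_add_left measurable_const, lintegral_const_mul _ hNa]
        simp only [lintegral_const, Measure.restrict_apply_univ]
        ring
    _ ≤ 2 * (L : Measure Arm) S * ∫⁻ ν', Φ ν' ∂(L : Measure Arm) +
          4 * (η * ((L : Measure Arm) S * ∫⁻ ν', N ν' ∂(L : Measure Arm) +
            (L : Measure Arm) W * ∫⁻ ν, N ν ∂(L : Measure Arm))) := by
        gcongr
        exact Measure.restrict_le_self
    _ = _ := by ring

/-- If the arms in `S` and those in `W` are hard to distinguish within `T` samples, then the output
arm falls into `S` with a probability that is not much larger than the ratio of the masses of `S`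
and of `W`. -/
theorem mul_experiment_outputArm_le {T : ℕ} (A : Algorithm T) (L : Reservoir)
    {S W : Set Arm} (hS : MeasurableSet S) (hW : MeasurableSet W) {η : ℝ≥0∞}
    (hSW : ∀ᵐ ν ∂(L : Measure Arm), ν ∈ S → ∀ᵐ ν' ∂(L : Measure Arm), ν' ∈ W →
      HellingerClose ν' ν η) :
    (L : Measure Arm) W * experiment L A {ω | ω.1 ω.2.2 ∈ S} ≤
      2 * (L : Measure Arm) S + 4 * (η * ((L : Measure Arm) W + (L : Measure Arm) S)) * T := by
  rw [experiment_outputArm L A hS, ← ENNReal.tsum_mul_left]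
  refine (ENNReal.tsum_le_tsum
    fun k => mul_lintegral_indicator_outputProb_le A L hS hW hSW k).trans_eq ?_
  rw [ENNReal.tsum_add, ENNReal.tsum_mul_left, ENNReal.tsum_mul_left,
    ← lintegral_tsum fun k => (measurable_outputProb A k).aemeasurable,
    ← lintegral_tsum fun k => (measurable_expPulls A T k).aemeasurable]
  simp [tsum_outputProb, tsum_expPulls]

/-! ### Two-point arms and their Hellinger affinity. -/

/-- The arm that gives the mass `q` to `C` and the mass `1 - q` to `-C`. -/
def twoPoint (C : ℝ) (q : I) : Arm := ⟨bernoulliMeasure C (-C) q, inferInstance⟩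

theorem coe_twoPoint (C : ℝ) (q : I) : (twoPoint C q : Measure ℝ) =
    ENNReal.ofReal q • Measure.dirac C + ENNReal.ofReal (1 - q) • Measure.dirac (-C) := by
  have h1 : ENNReal.ofReal q = unitInterval.toNNReal q := by
    rw [← ENNReal.ofReal_coe_nnreal, unitInterval.coe_toNNReal]
  have h2 : ENNReal.ofReal (1 - q) = unitInterval.toNNReal (σ q) := by
    rw [← ENNReal.ofReal_coe_nnreal, unitInterval.coe_toNNReal, unitInterval.coe_symm_eq]
  rw [h1, h2]
  rfl

theorem lintegral_twoPoint (C : ℝ) (q : I) (f : ℝ → ℝ≥0∞) :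
    ∫⁻ x, f x ∂(twoPoint C q : Measure ℝ) =
      ENNReal.ofReal q * f C + ENNReal.ofReal (1 - q) * f (-C) := by
  rw [coe_twoPoint, lintegral_add_measure, lintegral_smul_measure, lintegral_smul_measure,
    lintegral_dirac, lintegral_dirac, smul_eq_mul, smul_eq_mul]

theorem twoPoint_apply (C : ℝ) (q : I) {s : Set ℝ} (hs : MeasurableSet s) :
    (twoPoint C q : Measure ℝ) s =
      ENNReal.ofReal q * s.indicator 1 C + ENNReal.ofReal (1 - q) * s.indicator 1 (-C) := by
  rw [← lintegral_indicator_one hs, lintegral_twoPoint]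

theorem armMean_twoPoint (C : ℝ) (q : I) : armMean (twoPoint C q) = (2 * q - 1) * C := by
  simp only [armMean, twoPoint, ProbabilityMeasure.coe_mk, integral_bernoulliMeasure]
  simp
  ring

theorem measurable_twoPoint (C : ℝ) : Measurable (twoPoint C) := by
  refine Measurable.subtype_mk (Measure.measurable_of_measurable_coe _ fun s hs => ?_)
  have : (fun q : I => (twoPoint C q : Measure ℝ) s) = fun q : I =>
      ENNReal.ofReal q * s.indicator 1 C + ENNReal.ofReal (1 - q) * s.indicator 1 (-C) :=
    funext fun q => twoPoint_apply C q hs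
  exact this ▸ by fun_prop

theorem twoPoint_pair (C : ℝ) (q : I) : (twoPoint C q : Measure ℝ) {C, -C} = 1 := by
  have h1 : (0 : ℝ) ≤ 1 - q := sub_nonneg.2 q.2.2
  rw [twoPoint_apply C q (Set.to_countable _).measurableSet]
  simp [← ENNReal.ofReal_add q.2.1 h1]

theorem exists_eq_twoPoint {C : ℝ} (hC : 0 < C) {ν : Arm}
    (h : (ν : Measure ℝ) {C, -C} = 1) : ∃ q : I, ν = twoPoint C q := by
  have hne : C ≠ -C := by linarith
  have hd : Disjoint ({C} : Set ℝ) {-C} := by simpa using hne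
  have hadd : (ν : Measure ℝ) {C} + (ν : Measure ℝ) {-C} = 1 := by
    rw [← measure_union hd (measurableSet_singleton _), ← h]
    rfl
  have hq : (ν : Measure ℝ).real {C} + (ν : Measure ℝ).real {-C} = 1 := by
    rw [Measure.real, Measure.real, ← ENNReal.toReal_add (by simp) (by simp), hadd]
    simp
  have hmem : (ν : Measure ℝ).real {C} ∈ I :=
    Set.mem_Icc.2 ⟨measureReal_nonneg, measureReal_le_one⟩
  refine ⟨⟨(ν : Measure ℝ).real {C}, hmem⟩, Subtype.ext ?_⟩
  change (ν : Measure ℝ) = (twoPoint C ⟨_, hmem⟩ : Measure ℝ)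
  rw [coe_twoPoint]
  have e2 : 1 - (ν : Measure ℝ).real {C} = (ν : Measure ℝ).real {-C} := by linarith
  simp only [e2]
  simp only [measureReal_def, ENNReal.ofReal_toReal (measure_ne_top (ν : Measure ℝ) _)]
  rw [← Measure.restrict_singleton, ← Measure.restrict_singleton,
    ← Measure.restrict_union hd (measurableSet_singleton _)]
  refine (Measure.restrict_eq_self_of_ae_mem ?_).symm
  exact (prob_compl_eq_zero_iff (Set.to_countable ({C, -C} : Set ℝ)).measurableSet).2 h

/-- The affinity defect is half of `q' * (r - 1) ^ 2 + (1 - q') * (t - 1) ^ 2`, where `r` and `t`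
are the square roots of the likelihood ratios at the two atoms. Each term is at most `(q - q') ^ 2 /
δ`, because the reference law has atoms of mass at least `δ`. -/
theorem hellingerClose_twoPoint {C : ℝ} (hC : 0 < C) {q q' : I} {δ : ℝ} (hδ : 0 < δ)
    (h0 : δ ≤ q') (h1 : (q' : ℝ) ≤ 1 - δ) :
    HellingerClose (twoPoint C q') (twoPoint C q)
      (ENNReal.ofReal (((q : ℝ) - q') ^ 2 / δ)) := by
  have hq0 := q.2.1
  have hq1 : 0 ≤ 1 - (q : ℝ) := sub_nonneg.2 q.2.2
  have hp0 : 0 < (q' : ℝ) := by linarith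
  have hp1 : 0 < 1 - (q' : ℝ) := by linarith
  have hne : -C ≠ C := by linarith
  set r : ℝ := Real.sqrt (q / q') with hr
  set t : ℝ := Real.sqrt ((1 - q) / (1 - q')) with ht
  have hr0 : 0 ≤ r := Real.sqrt_nonneg _
  have ht0 : 0 ≤ t := Real.sqrt_nonneg _
  have hr2 : (q' : ℝ) * r ^ 2 = q := by
    rw [hr, Real.sq_sqrt (by positivity)]
    field_simp
  have ht2 : (1 - q' : ℝ) * t ^ 2 = 1 - q := by
    rw [ht, Real.sq_sqrt (by positivity)]
    field_simp
  refine ⟨fun x => if x = C then r.toNNReal else t.toNNReal,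
    Measurable.ite (measurableSet_singleton C) measurable_const measurable_const, ?_, ?_⟩
  · ext s hs
    rw [withDensity_apply _ hs, ← lintegral_indicator hs, lintegral_twoPoint, twoPoint_apply C q hs]
    have e1 : ENNReal.ofReal q = ENNReal.ofReal q' * (r.toNNReal : ℝ≥0∞) ^ 2 := by
      rw [← hr2, ENNReal.ofReal_mul hp0.le, ENNReal.ofReal_pow hr0]
      rfl
    have e2 : ENNReal.ofReal (1 - q) = ENNReal.ofReal (1 - q') * (t.toNNReal : ℝ≥0∞) ^ 2 := by
      rw [← ht2, ENNReal.ofReal_mul hp1.le, ENNReal.ofReal_pow ht0]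
      rfl
    rw [e1, e2]
    by_cases hc : C ∈ s <;> by_cases hc' : -C ∈ s <;> simp [hc, hc', hne]
  · rw [lintegral_twoPoint]
    simp only [if_true, if_neg hne]
    have key : 1 ≤ q' * r + (1 - q') * t + ((q : ℝ) - q') ^ 2 / δ := by
      have hd : ((q : ℝ) - q') ^ 2 / δ * δ = ((q : ℝ) - q') ^ 2 := by field_simp
      set d := ((q : ℝ) - q') ^ 2 / δ
      have b1 : q' * (r - 1) ^ 2 ≤ d := by
        refine le_of_mul_le_mul_right ?_ hδ
        calc q' * (r - 1) ^ 2 * δ ≤ q' * (r - 1) ^ 2 * q' := by gcongr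
          _ = (q' * (r - 1)) ^ 2 * 1 := by ring
          -- As `r + 1 ≥ 1`, the difference of square roots is controlled by the difference of the
          -- masses.
          _ ≤ (q' * (r - 1)) ^ 2 * (r + 1) ^ 2 := by
            gcongr
            nlinarith
          _ = (q' * r ^ 2 - q') ^ 2 := by ring
          _ = d * δ := by rw [hr2, hd]
      have b2 : (1 - q') * (t - 1) ^ 2 ≤ d := by
        refine le_of_mul_le_mul_right ?_ hδ
        calc (1 - q') * (t - 1) ^ 2 * δ ≤ (1 - q') * (t - 1) ^ 2 * (1 - q') := by
              gcongr
              linarith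
          _ = ((1 - q') * (t - 1)) ^ 2 * 1 := by ring
          _ ≤ ((1 - q') * (t - 1)) ^ 2 * (t + 1) ^ 2 := by
            gcongr
            nlinarith
          _ = ((1 - q') * t ^ 2 - (1 - q')) ^ 2 := by ring
          _ = d * δ := by rw [ht2, hd]; ring
      nlinarith
    rw [← ENNReal.ofReal_one]
    refine (ENNReal.ofReal_le_ofReal key).trans_eq ?_
    rw [ENNReal.ofReal_add (by positivity) (by positivity),
      ENNReal.ofReal_add (by positivity) (by positivity), ENNReal.ofReal_mul hp0.le,
      ENNReal.ofReal_mul hp1.le]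
    rfl

/-- The two-point arm on `{-C, C}` of mean `m`, for `m` between `-C` and `C`. -/
def meanArm (C m : ℝ) : Arm := twoPoint C (Set.projIcc 0 1 zero_le_one ((C + m) / (2 * C)))

theorem measurable_meanArm (C : ℝ) : Measurable (meanArm C) :=
  (measurable_twoPoint C).comp
    (continuous_projIcc.measurable.comp ((measurable_id.const_add C).div_const (2 * C)))

theorem coe_projIcc_mean {C m : ℝ} (hC : 0 < C) (hm : m ∈ Set.Icc (-C) C) :
    (Set.projIcc 0 1 zero_le_one ((C + m) / (2 * C)) : ℝ) = (C + m) / (2 * C) := by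
  have : (C + m) / (2 * C) ∈ Set.Icc (0 : ℝ) 1 :=
    ⟨div_nonneg (by linarith [hm.1]) (by linarith), (div_le_one (by linarith)).2 (by linarith [hm.2])⟩
  rw [Set.projIcc_of_mem _ this]

theorem armMean_meanArm {C m : ℝ} (hC : 0 < C) (hm : m ∈ Set.Icc (-C) C) :
    armMean (meanArm C m) = m := by
  rw [meanArm, armMean_twoPoint, coe_projIcc_mean hC hm]
  field_simp
  ring

theorem eq_meanArm {C : ℝ} (hC : 0 < C) {ν : Arm} (h : (ν : Measure ℝ) {C, -C} = 1) :
    ν = meanArm C (armMean ν) := by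
  obtain ⟨q, rfl⟩ := exists_eq_twoPoint hC h
  have : (C + (2 * q - 1) * C) / (2 * C) = (q : ℝ) := by
    field_simp
    ring
  rw [meanArm, armMean_twoPoint, this, Set.projIcc_val]

theorem hellingerClose_meanArm {C m m' δ : ℝ} (hC : 0 < C) (hδ : 0 < δ)
    (hm : m ∈ Set.Icc (-C) C) (h0 : 2 * C * δ ≤ C + m') (h1 : 2 * C * δ ≤ C - m') :
    HellingerClose (meanArm C m') (meanArm C m)
      (ENNReal.ofReal ((m - m') ^ 2 / (4 * C ^ 2 * δ))) := by
  have hp : 0 < 2 * C * δ := by positivity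
  have hm' : m' ∈ Set.Icc (-C) C := ⟨by linarith, by linarith⟩
  have e : (m - m') ^ 2 / (4 * C ^ 2 * δ) =
      ((C + m) / (2 * C) - (C + m') / (2 * C)) ^ 2 / δ := by
    field_simp
    ring
  rw [e, ← coe_projIcc_mean hC hm, ← coe_projIcc_mean hC hm']
  refine hellingerClose_twoPoint hC hδ ?_ ?_
  · rw [coe_projIcc_mean hC hm', le_div_iff₀ (by linarith)]
    linarith
  · rw [coe_projIcc_mean hC hm', div_le_iff₀ (by linarith)]
    linarith

/-! ### Replacing a reservoir by two-point arms with the same means. -/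

theorem isProbabilityMeasure_meanReservoir (L : Reservoir) :
    IsProbabilityMeasure (meanReservoir L) :=
  Measure.isProbabilityMeasure_map measurable_armMean.aemeasurable

theorem armMean_mem_Icc {C : ℝ} {ν : Arm} (h : (ν : Measure ℝ) (Set.Icc (-C) C) = 1) :
    armMean ν ∈ Set.Icc (-C) C := by
  have hae : ∀ᵐ x ∂(ν : Measure ℝ), x ∈ Set.Icc (-C) C :=
    (prob_compl_eq_zero_iff measurableSet_Icc).2 h
  have hi : Integrable (fun x : ℝ => x) (ν : Measure ℝ) := by
    refine Integrable.of_bound measurable_id.aestronglyMeasurable C ?_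
    filter_upwards [hae] with x hx
    exact abs_le.2 hx
  exact (convex_Icc (-C) C).integral_mem isClosed_Icc hae hi

theorem ae_meanReservoir_mem_Icc {L : Reservoir} {C : ℝ} (h : BoundedArms L C) :
    ∀ᵐ m ∂meanReservoir L, m ∈ Set.Icc (-C) C := by
  refine (ae_map_iff measurable_armMean.aemeasurable
    (measurableSet_Icc : MeasurableSet (Set.Icc (-C) C))).2 ?_
  filter_upwards [h] with ν hν using armMean_mem_Icc hν

/-- The reservoir of two-point arms with the same mean reservoir distribution as `L`. -/
def twoPointReservoir (L : Reservoir) (C : ℝ) : Reservoir :=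
  ⟨(meanReservoir L).map (meanArm C),
    haveI := isProbabilityMeasure_meanReservoir L
    Measure.isProbabilityMeasure_map (measurable_meanArm C).aemeasurable⟩

theorem meanReservoir_twoPointReservoir {L : Reservoir} {C : ℝ} (hC : 0 < C)
    (h : BoundedArms L C) : meanReservoir (twoPointReservoir L C) = meanReservoir L := by
  have : ((meanReservoir L).map (meanArm C)).map armMean = meanReservoir L := by
    rw [Measure.map_map measurable_armMean (measurable_meanArm C)]
    conv_rhs => rw [← Measure.map_id (μ := meanReservoir L)]
    refine Measure.map_congr ?_
    filter_upwards [ae_meanReservoir_mem_Icc h] with m hm using armMean_meanArm hC hm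
  exact this

theorem rightEnd_twoPointReservoir {L : Reservoir} {C : ℝ} (hC : 0 < C)
    (h : BoundedArms L C) : rightEnd (twoPointReservoir L C) = rightEnd L := by
  rw [rightEnd, meanReservoir_twoPointReservoir hC h, rightEnd]

theorem ae_twoPointReservoir (L : Reservoir) (C : ℝ) :
    ∀ᵐ ν : Arm ∂(twoPointReservoir L C : Measure Arm), (ν : Measure ℝ) {C, -C} = 1 := by
  have hm : MeasurableSet {ν : Arm | (ν : Measure ℝ) {C, -C} = 1} :=
    ((Measure.measurable_coe (Set.to_countable _).measurableSet).comp measurable_subtype_coe)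
      (measurableSet_singleton 1)
  exact (ae_map_iff (measurable_meanArm C).aemeasurable hm).2
    (ae_of_all _ fun m => twoPoint_pair C _)

theorem boundedArms_twoPointReservoir (L : Reservoir) {C : ℝ} (hC : 0 < C) :
    BoundedArms (twoPointReservoir L C) C := by
  have h : -C ≤ C := by linarith
  filter_upwards [ae_twoPointReservoir L C] with ν hν
  refine le_antisymm prob_le_one (hν.symm.le.trans (measure_mono ?_))
  simp [Set.insert_subset_iff, h]

/-- Regularity and the right end point depend only on the law of the mean, and this is unchanged. -/
theorem twoPointReservoir_mem {L : Reservoir} {β E E' B C : ℝ} (hC : 0 < C)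
    (h : L ∈ reservoirClass β E E' B C) :
    twoPointReservoir L C ∈ reservoirClass β E E' B C := by
  refine ⟨boundedArms_twoPointReservoir L hC, fun ε h0 h1 => ?_⟩
  rw [rightEnd_twoPointReservoir hC h.1, meanReservoir_twoPointReservoir hC h.1]
  exact h.2 ε h0 h1

theorem HellingerClose.mono {ν' ν : Arm} {η η' : ℝ≥0∞} (h : HellingerClose ν' ν η)
    (hη : η ≤ η') : HellingerClose ν' ν η' := by
  obtain ⟨s, hs, hν, h1⟩ := h
  exact ⟨s, hs, hν, h1.trans (add_le_add le_rfl hη)⟩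

/-! ### The two lower bounds. -/

theorem measurableSet_lt_armMean (x : ℝ) : MeasurableSet {ν : Arm | x < armMean ν} :=
  measurable_armMean measurableSet_Ioi

theorem meanReservoir_real_Ioi (L : Reservoir) (x : ℝ) :
    (meanReservoir L).real (Set.Ioi x) = (L : Measure Arm).real {ν | x < armMean ν} :=
  map_measureReal_apply measurable_armMean measurableSet_Ioi

theorem one_third_lt_simpleRegret {T : ℕ} {L : Reservoir} {A : Algorithm T} {ε : ℝ}
    (h : (experiment L A).real {ω | ω.1 ω.2.2 ∈ {ν | rightEnd L - ε < armMean ν}} < 2 / 3) :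
    1 / 3 < (experiment L A).real {ω | ε ≤ simpleRegret L ω} := by
  have e : {ω : Arms × History T × ℕ | ε ≤ simpleRegret L ω} =
      {ω | ω.1 ω.2.2 ∈ {ν | rightEnd L - ε < armMean ν}}ᶜ := by
    ext ω
    change ε ≤ rightEnd L - armMean (ω.1 ω.2.2) ↔ ¬ (rightEnd L - ε < armMean (ω.1 ω.2.2))
    rw [not_lt]
    constructor <;> intro h <;> linarith
  have hm : MeasurableSet {ω : Arms × History T × ℕ |
      ω.1 ω.2.2 ∈ {ν | rightEnd L - ε < armMean ν}} :=
    measurable_outputArm (measurableSet_lt_armMean _)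
  rw [e, probReal_compl_eq_one_sub hm]
  linarith

theorem exists_pos_le_mul_rpow_le {β E' B : ℝ} (hβ : 0 < β) (hE' : 0 < E') (hB : 0 < B) :
    ∃ v : ℝ, 0 < v ∧ v ≤ B ∧ E' * v ^ β ≤ 1 / 2 := by
  have h0 : 0 < (1 / (2 * E')) ^ (1 / β) := by positivity
  refine ⟨min B ((1 / (2 * E')) ^ (1 / β)), lt_min hB h0, min_le_left _ _, ?_⟩
  calc E' * min B ((1 / (2 * E')) ^ (1 / β)) ^ β
      ≤ E' * ((1 / (2 * E')) ^ (1 / β)) ^ β := by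
        gcongr
        exact min_le_right _ _
    _ = 1 / 2 := by
        rw [← Real.rpow_mul (by positivity), one_div_mul_cancel hβ.ne', Real.rpow_one]
        field_simp

theorem ae_armMean_le_rightEnd {L : Reservoir} {β E E' B : ℝ} (hβ : 0 < β) (hB : 0 < B)
    (h : Regular L β E E' B) : ∀ᵐ ν ∂(L : Measure Arm), armMean ν ≤ rightEnd L := by
  have h0 := (h 0 le_rfl hB.le).2
  rw [Real.zero_rpow hβ.ne', mul_zero, sub_zero, meanReservoir_real_Ioi] at h0
  have h1 := (measureReal_eq_zero_iff).1 (le_antisymm h0 measureReal_nonneg)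
  rw [ae_iff]
  simpa using h1

/-- Otherwise every mean exceeds `rightEnd L - v` for each `v > 0`, whereas regularity gives that
event mass at most 1/2 for a small `v`. So the means near the right end keep away from `-C`. -/
theorem neg_lt_rightEnd {L : Reservoir} {β E E' B C : ℝ} (hβ : 0 < β) (hE' : 0 < E') (hB : 0 < B)
    (h : L ∈ reservoirClass β E E' B C) : -C < rightEnd L := by
  by_contra! hr
  obtain ⟨v, hv, hvB, hvE⟩ := exists_pos_le_mul_rpow_le hβ hE' hB
  have h1 := (h.2 v hv.le hvB).2
  have h2 : (meanReservoir L).real (Set.Ioi (rightEnd L - v)) = 1 := by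
    have := isProbabilityMeasure_meanReservoir L
    have hae : Set.Ioi (rightEnd L - v) ∈ ae (meanReservoir L) := by
      filter_upwards [ae_meanReservoir_mem_Icc h.1] with m hm
      exact Set.mem_Ioi.2 (by linarith [hm.1])
    rw [Measure.real, (mem_ae_iff_prob_eq_one measurableSet_Ioi).1 hae, ENNReal.toReal_one]
  linarith

theorem exists_lt_simpleRegret_of_nonempty {β E E' B C : ℝ} (hβ : 0 < β) (hE' : 0 < E')
    (hB : 0 < B) (hne : (reservoirClass β E E' B C).Nonempty) :
    ∃ v : ℝ, 0 < v ∧ ∃ T₀ : ℕ, ∀ T : ℕ, T₀ ≤ T → ∀ A : Algorithm T,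
      ∃ L ∈ reservoirClass β E E' B C,
        1 / 3 < (experiment L A).real {ω | v * (T : ℝ) ^ (-(1 / β)) ≤ simpleRegret L ω} := by
  obtain ⟨L, hL⟩ := hne
  obtain ⟨v, hv, hvB, hvE⟩ := exists_pos_le_mul_rpow_le hβ hE' hB
  -- `T ≥ 1` keeps `ε ≤ v ≤ B`, within the range of regularity.
  refine ⟨v, hv, 1, fun T hT A => ⟨L, hL, one_third_lt_simpleRegret ?_⟩⟩
  have hT1 : (1 : ℝ) ≤ T := by exact_mod_cast hT
  have hT0 : (0 : ℝ) < T := by linarith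
  set ε := v * (T : ℝ) ^ (-(1 / β)) with hε
  have hε0 : 0 ≤ ε := by positivity
  have hεB : ε ≤ B := by
    refine (mul_le_of_le_one_right hv.le ?_).trans hvB
    exact Real.rpow_le_one_of_one_le_of_nonpos hT1 (by simp [hβ.le])
  have hεβ : ε ^ β * T = v ^ β := by
    rw [hε, Real.mul_rpow hv.le (by positivity), ← Real.rpow_mul hT0.le, neg_mul,
      one_div_mul_cancel hβ.ne', Real.rpow_neg_one, inv_mul_cancel_right₀ hT0.ne']
  have h1 := (hL.2 ε hε0 hεB).2
  rw [meanReservoir_real_Ioi] at h1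
  have h2 := ENNReal.toReal_mono (by finiteness)
    (experiment_outputArm_le L A (measurableSet_lt_armMean (rightEnd L - ε)))
  rw [ENNReal.toReal_mul, ENNReal.toReal_natCast] at h2
  calc _ ≤ _ := h2
    _ ≤ T * (E' * ε ^ β) := by gcongr; exact h1
    _ = E' * v ^ β := by rw [← hεβ]; ring
    _ < 2 / 3 := by linarith

/-- Almost surely both means lie within `w ≤ c / 2` below the right end, hence differ by at most `w`
and stay at distance at least `c / 2` from `-C` and `C`. The atoms then have mass at least `δ = c /
(4 * C)`, and `4 * C ^ 2 * δ = c * C`. -/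
theorem hellingerClose_of_near_rightEnd {L : Reservoir} {β E E' B C : ℝ} (hβ : 0 < β) (hB : 0 < B)
    (hC : 0 < C) (hL : L ∈ reservoirClass β E E' B C)
    (h2 : ∀ᵐ ν : Arm ∂(L : Measure Arm), (ν : Measure ℝ) {C, -C} = 1) {c w : ℝ} (hc : 0 < c)
    (hcl : c ≤ C + rightEnd L) (hcr : c ≤ C - rightEnd L) (hw : w ≤ c / 2) :
    ∀ᵐ ν ∂(L : Measure Arm), rightEnd L - w < armMean ν → ∀ᵐ ν' ∂(L : Measure Arm),
      rightEnd L - w < armMean ν' → HellingerClose ν' ν (ENNReal.ofReal (w ^ 2 / (c * C))) := by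
  have hr := ae_armMean_le_rightEnd hβ hB hL.2
  filter_upwards [hr, h2, hL.1] with ν hν1 hν2 hν3 hνw
  filter_upwards [hr, h2] with ν' hν1' hν2' hνw'
  rw [eq_meanArm hC hν2, eq_meanArm hC hν2']
  have e : 2 * C * (c / (4 * C)) = c / 2 := by field_simp; norm_num
  have e' : 4 * C ^ 2 * (c / (4 * C)) = c * C := by field_simp
  refine (hellingerClose_meanArm (δ := c / (4 * C)) hC (by positivity) (armMean_mem_Icc hν3)
    (by linarith) (by linarith)).mono ?_
  rw [e']
  refine ENNReal.ofReal_le_ofReal ?_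
  gcongr ?_ / _
  exact sq_le_sq' (by linarith) (by linarith)

/-- Chooses the widening factor: enlarging the window from `ε` to `K * ε` multiplies the mass by at
least 8, even between the upper and the lower regularity bounds. -/
theorem exists_one_le_mul_rpow_le {β E E' : ℝ} (hβ : 0 < β) (hE : 0 < E) (hE' : 0 < E') :
    ∃ K : ℝ, 1 ≤ K ∧ 8 * E' ≤ E * K ^ β := by
  refine ⟨max 1 ((8 * E' / E) ^ (1 / β)), le_max_left _ _, ?_⟩
  calc 8 * E' = E * ((8 * E' / E) ^ (1 / β)) ^ β := by
        rw [← Real.rpow_mul (by positivity), one_div_mul_cancel hβ.ne', Real.rpow_one]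
        field_simp
    _ ≤ _ := by
        gcongr
        exact le_max_right _ _

theorem exists_lt_simpleRegret_of_rightEnd_lt {β E E' B C : ℝ} (hβ : 0 < β) (hE : 0 < E)
    (hE' : 0 < E') (hB : 0 < B) (hC : 0 < C)
    (hne : ∃ L ∈ reservoirClass β E E' B C, rightEnd L < C) :
    ∃ v : ℝ, 0 < v ∧ ∃ T₀ : ℕ, ∀ T : ℕ, T₀ ≤ T → ∀ A : Algorithm T,
      ∃ L ∈ reservoirClass β E E' B C,
        1 / 3 < (experiment L A).real
          {ω | v * (T : ℝ) ^ (-(1 / 2) : ℝ) ≤ simpleRegret L ω} := by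
  obtain ⟨L₀, hL₀, hr₀⟩ := hne
  set L := twoPointReservoir L₀ C with hLdef
  have hL : L ∈ reservoirClass β E E' B C := twoPointReservoir_mem hC hL₀
  have h2 := ae_twoPointReservoir L₀ C
  rw [← hLdef] at h2
  rw [← rightEnd_twoPointReservoir hC hL₀.1, ← hLdef] at hr₀
  have hrC := neg_lt_rightEnd hβ hE' hB hL
  obtain ⟨K, hK1, hK⟩ := exists_one_le_mul_rpow_le hβ hE hE'
  have hK0 : 0 < K := by linarith
  set c := min (C + rightEnd L) (C - rightEnd L) with hcdef
  have hc : 0 < c := lt_min (by linarith) (by linarith)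
  have hcl : c ≤ C + rightEnd L := min_le_left _ _
  have hcr : c ≤ C - rightEnd L := min_le_right _ _
  -- The wide window is `K * ε = u * T ^ (-1/2)`: `u ≤ B` keeps it in the range of regularity, and
  -- `u ≤ c / 8` makes `η * T` small.
  set u := min B (c / 8) with hudef
  have hu : 0 < u := lt_min hB (by positivity)
  have huB : u ≤ B := min_le_left _ _
  have huc : u ≤ c / 8 := min_le_right _ _
  refine ⟨u / K, by positivity, 1, fun T hT A => ⟨L, hL, one_third_lt_simpleRegret ?_⟩⟩
  have hT1 : (1 : ℝ) ≤ T := by exact_mod_cast hT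
  have hT0 : (0 : ℝ) < T := by linarith
  set ε := u / K * (T : ℝ) ^ (-(1 / 2) : ℝ) with hε
  have hε0 : 0 < ε := by positivity
  have hw : K * ε = u * (T : ℝ) ^ (-(1 / 2) : ℝ) := by
    rw [hε]
    field_simp
  have hwu : K * ε ≤ u := by
    rw [hw]
    exact mul_le_of_le_one_right hu.le
      (Real.rpow_le_one_of_one_le_of_nonpos hT1 (by norm_num))
  have hεw : ε ≤ K * ε := le_mul_of_one_le_left hε0.le hK1
  have hwT : (K * ε) ^ 2 * T = u ^ 2 := by
    rw [hw, mul_pow, ← Real.rpow_natCast ((T : ℝ) ^ (-(1 / 2) : ℝ)), ← Real.rpow_mul hT0.le]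
    norm_num [Real.rpow_neg_one, mul_assoc, inv_mul_cancel₀ hT0.ne']
  have hS := measurableSet_lt_armMean (rightEnd L - ε)
  have hW := measurableSet_lt_armMean (rightEnd L - K * ε)
  have hclose := hellingerClose_of_near_rightEnd hβ hB hC hL h2 hc hcl hcr
    (w := K * ε) (by linarith)
  have main := mul_experiment_outputArm_le A L hS hW
    (η := ENNReal.ofReal ((K * ε) ^ 2 / (c * C))) (by
      filter_upwards [hclose] with ν hν hνS
      exact hν (lt_of_le_of_lt (by linarith) hνS))
  have main' := ENNReal.toReal_mono (by finiteness) main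
  rw [ENNReal.toReal_add (by finiteness) (by finiteness)] at main'
  simp only [ENNReal.toReal_mul, ENNReal.toReal_add (measure_ne_top (L : Measure Arm) _)
    (measure_ne_top (L : Measure Arm) _), ENNReal.toReal_natCast, ENNReal.toReal_ofNat] at main'
  rw [ENNReal.toReal_ofReal (by positivity)] at main'
  have hlow := (hL.2 (K * ε) (by positivity) (by linarith)).1
  have hup := (hL.2 ε hε0.le (by linarith)).2
  rw [meanReservoir_real_Ioi] at hlow hup
  simp only [← measureReal_def] at main'
  set PW := (L : Measure Arm).real {ν | rightEnd L - K * ε < armMean ν}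
  set PS := (L : Measure Arm).real {ν | rightEnd L - ε < armMean ν}
  set P := (experiment L A).real {ω | ω.1 ω.2.2 ∈ {ν | rightEnd L - ε < armMean ν}}
  have hPW : 0 < PW := lt_of_lt_of_le (by positivity) hlow
  have hPS : 8 * PS ≤ PW := by
    calc 8 * PS ≤ 8 * E' * ε ^ β := by linarith
      _ ≤ E * K ^ β * ε ^ β := by gcongr
      _ = E * (K * ε) ^ β := by rw [Real.mul_rpow hK0.le hε0.le, mul_assoc]
      _ ≤ PW := hlow
  -- The left side is `u ^ 2 / (c * C)`, with `u ≤ c / 8` and `c ≤ C`; the latter follows by adding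
  -- `hcl` and `hcr`.
  have hη : (K * ε) ^ 2 / (c * C) * T ≤ 1 / 64 := by
    rw [div_mul_eq_mul_div, hwT, div_le_iff₀ (by positivity)]
    nlinarith
  -- With `PS ≤ PW / 8`, the bound is `1/4 + (1/16) * (9/8)` times `PW`, below `3/8`.
  have hfin : PW * P ≤ PW * (3 / 8) := by
    calc PW * P ≤ 2 * PS + 4 * ((K * ε) ^ 2 / (c * C) * (PW + PS)) * T := main'
      _ = 2 * PS + 4 * ((K * ε) ^ 2 / (c * C) * T) * (PW + PS) := by ring
      _ ≤ 2 * PS + 4 * (1 / 64) * (PW + PS) := by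
          have : 0 ≤ PS := measureReal_nonneg
          gcongr
      _ ≤ PW * (3 / 8) := by linarith
  have := le_of_mul_le_mul_left hfin hPW
  linarith

end InfBandit

end
open InfBandit in
theorem mainTheorem10 (β E E' B C : ℝ) (hβ : 0 < β) (hE : 0 < E) (hE' : 0 < E')
    (hB : 0 < B) (hB1 : B < 1) (hC : 0 < C) :
    (β < 2 → (∃ L ∈ reservoirClass β E E' B C, rightEnd L < C) →
      ∃ v : ℝ, 0 < v ∧ ∃ T₀ : ℕ, ∀ T : ℕ, T₀ ≤ T → ∀ A : Algorithm T,
        ∃ L ∈ reservoirClass β E E' B C,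
          1 / 3 < (experiment L A).real {ω | v * (T : ℝ) ^ (-(1 / 2) : ℝ) ≤ simpleRegret L ω}) ∧
    (2 ≤ β → (reservoirClass β E E' B C).Nonempty →
      ∃ v : ℝ, 0 < v ∧ ∃ T₀ : ℕ, ∀ T : ℕ, T₀ ≤ T → ∀ A : Algorithm T,
        ∃ L ∈ reservoirClass β E E' B C,
          1 / 3 < (experiment L A).real {ω | v * (T : ℝ) ^ (-(1 / β)) ≤ simpleRegret L ω}) := by
  exact ⟨fun _ hne => exists_lt_simpleRegret_of_rightEnd_lt hβ hE hE' hB hC hne,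
    fun _ hne => exists_lt_simpleRegret_of_nonempty hβ hE' hB hne⟩
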